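/- Let $m,n,p$ be positive integers and let $\mathbb{R}^n$ carry the Euclidean norm. Let $S^p$ be the space of real symmetric $p\times p$ matrices with the scalar product $A\bullet B=\operatorname{trace}(AB)$, let $\|A\|=\sqrt{A\bullet A}$, and let $S^p_+\subset S^p$ be the set of positive semidefinite matrices. Let $f_1,\dots,f_m:\mathbb{R}^n\to\mathbb{R}$ be locally Lipschitz, let $\Omega\subset\mathbb{R}^n$ be nonempty, closed and convex, let $F_0,F_1,\dots,F_n\in S^p$, and put $g(x)=F_0+\sum_{i=1}^n x_iF_i$ and $C=\{x\in\Omega : g(x)\preceq 0\}$. For a locally Lipschitz function $\varphi:\mathbb{R}^n\to\mathbb{R}$ let $\varphi^\circ(x;d)=\limsup_{y\to x,\ t\downarrow 0}\frac{\varphi(y+td)-\varphi(y)}{t}$ be the Clarke directional derivative and $\partial\varphi(x)=\{u : \langle u,d\rangle\le\varphi^\circ(x;d)\ \forall d\in\mathbb{R}^n\}$ the Clarke subdifferential. Let $T(x;\Omega)=\{v : d_\Omega^\circ(x;v)=0\}$ be the Clarke tangent cone, where $d_\Omega$ is the distance function of $\Omega$, and let $N(x;\Omega)=\{u : \langle u,v\rangle\le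 0\ \forall v\in T(x;\Omega)\}$ be the Clarke normal cone. Let $\xi\in\mathbb{R}^m_+\setminus\{0\}$, and let $\bar x\in C$ be a $\xi$-quasi-weakly Pareto solution, i.e. there is no $x\in C$ with $f_i(x)+\|x-\bar x\|\,\xi_i<f_i(\bar x)$ for all $i=1,\dots,m$. Assume the Slater-type condition that there is $\bar d\in T(\bar x;\Omega)$ with $G^\circ(\bar x;\bar d)<0$, where $G(x)=\max\{\Lambda\bullet g(x) : \Lambda\in S^p_+,\ \|\Lambda\|=1\}$. Then there exist $\lambda\in\mathbb{R}^m_+$ with $\sum_{i=1}^m\lambda_i=1$ and $\Lambda\in S^p_+$ such that $$0\in\sum_{i=1}^m\lambda_i\,\partial f_i(\bar x)+(\Lambda\bullet F_1,\dots,\Lambda\bullet F_n)+\Big(\sum_{i=1}^m\lambda_i\xi_i\Big)B+N(\bar x;\Omega),$$ where $B$ is the closed unit ball of $\mathbb{R}^n$. -/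

import Mathlib

open Filter Topology
open scoped Pointwise

noncomputable section

section Clarke

variable {X : Type*} [NormedAddCommGroup X] [NormedSpace ℝ X]

/-- Clarke's generalized directional derivative
`φ°(x; d) = limsup_{y → x, t ↓ 0} (φ (y + t d) - φ y) / t` (used for locally Lipschitz `φ`,
for which the difference quotients are bounded near the limit). -/
def clarkeDirDeriv (φ : X → ℝ) (x d : X) : ℝ :=
  limsup (fun q : X × ℝ => (φ (q.1 + q.2 • d) - φ q.1) / q.2) (𝓝 x ×ˢ 𝓝[>] (0 : ℝ))

/-- The Clarke subdifferential, a subset of the dual space. -/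
def clarkeSubdifferential (φ : X → ℝ) (x : X) : Set (StrongDual ℝ X) :=
  {u | ∀ d : X, u d ≤ clarkeDirDeriv φ x d}

/-- The Clarke tangent cone to `S` at `x`, through the distance function of `S`. -/
def clarkeTangentCone (S : Set X) (x : X) : Set X :=
  {v | clarkeDirDeriv (fun y => Metric.infDist y S) x v = 0}

/-- The Clarke normal cone: the polar cone of the Clarke tangent cone. -/
def clarkeNormalCone (S : Set X) (x : X) : Set (StrongDual ℝ X) :=
  {u | ∀ v ∈ clarkeTangentCone S x, u v ≤ 0}

/-- `x` is a `ξ`-quasi-weakly Pareto solution of minimizing `f = (f₁, …, fₘ)` over `C`, with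
respect to the nonnegative orthant. -/
def IsQuasiWeaklyPareto {m : ℕ} (f : Fin m → X → ℝ) (C : Set X) (ξ : Fin m → ℝ) (x : X) : Prop :=
  x ∈ C ∧ ¬ ∃ y ∈ C, ∀ i, f i y + ‖y - x‖ * ξ i < f i x

/-- The condition (𝒰) at `x`: some Clarke tangent direction `d` of `Ω` has `G°(x; d) < 0`. -/
def SlaterCondition (Ω : Set X) (G : X → ℝ) (x : X) : Prop :=
  ∃ d ∈ clarkeTangentCone Ω x, clarkeDirDeriv G x d < 0

end Clarke

section Semidefinite

variable {n p : ℕ}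

/-- The scalar product `A • B = trace (A B)` of symmetric matrices. -/
def traceProd (A B : Matrix (Fin p) (Fin p) ℝ) : ℝ := (A * B).trace

/-- The affine matrix map `g(x) = F₀ + ∑ xᵢ Fᵢ`. -/
def affineMatrixMap (F₀ : Matrix (Fin p) (Fin p) ℝ) (F : Fin n → Matrix (Fin p) (Fin p) ℝ)
    (x : EuclideanSpace ℝ (Fin n)) : Matrix (Fin p) (Fin p) ℝ :=
  F₀ + ∑ i, x i • F i

/-- The feasible set `{x ∈ Ω | g(x) ⪯ 0}`. -/
def sdFeasibleSet (Ω : Set (EuclideanSpace ℝ (Fin n)))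
    (g : EuclideanSpace ℝ (Fin n) → Matrix (Fin p) (Fin p) ℝ) : Set (EuclideanSpace ℝ (Fin n)) :=
  {x | x ∈ Ω ∧ (-(g x)).PosSemidef}

/-- The positive semidefinite matrices of Frobenius norm one: a compact set of indices for the
scalar form of the constraint, `g(x) ⪯ 0 ↔ Λ • g(x) ≤ 0` for all `Λ` in this set. -/
def unitPosSemidef (p : ℕ) : Set (Matrix (Fin p) (Fin p) ℝ) :=
  {Λ | Λ.PosSemidef ∧ traceProd Λ Λ = 1}

/-- The constraint function `G(x) = max {Λ • g(x) | Λ ⪰ 0, ‖Λ‖ = 1}`. -/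
def sdConstraintMax (g : EuclideanSpace ℝ (Fin n) → Matrix (Fin p) (Fin p) ℝ)
    (x : EuclideanSpace ℝ (Fin n)) : ℝ :=
  sSup ((fun Λ => traceProd Λ (g x)) '' unitPosSemidef p)

/-- `Λ • F = (Λ • F₁, …, Λ • Fₙ)`, as an element of the dual of `ℝⁿ`. -/
def traceProdVec (Λ : Matrix (Fin p) (Fin p) ℝ) (F : Fin n → Matrix (Fin p) (Fin p) ℝ) :
    StrongDual ℝ (EuclideanSpace ℝ (Fin n)) :=
  InnerProductSpace.toDual ℝ (EuclideanSpace ℝ (Fin n))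
    (WithLp.toLp 2 fun i => traceProd Λ (F i))

end Semidefinite

end

/-! ### Calculus of Clarke derivatives, subdifferentials, tangent and normal cones. -/

section ClarkeCalculus

variable {X : Type*} [NormedAddCommGroup X] [NormedSpace ℝ X]

/-! Put `h i y = f_i°(x̄; y - x̄) + ξ i * ‖y - x̄‖`, a convex function of `y`. No `y ∈ Ω` makes
every `h i y` negative and `g y` negative definite: such a `y` is feasible, and since the feasible
set is convex, a short step from `x̄` towards `y` would contradict quasi-weak Pareto optimality
(`IsQuasiWeaklyPareto.not_exists_clarkeDirDeriv_lt`). Separation then gives `l ≥ 0` and `Λ ⪰ 0` with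
`∑ l i * h i y + Λ • g y ≥ 0` on `Ω` (`exists_multipliers_of_not_exists_lt`). A strictly feasible
point, supplied by the Slater condition, forces `l ≠ 0`, so `l` can be normalized.

As `g` is affine and `Λ • g x̄ ≤ 0`, the sublinear function `Ψ d = ∑ l i * f_i°(x̄; d) + (Λ • F) d +
c * ‖d‖`, with `c = ∑ l i * ξ i`, is nonnegative on `Ω - x̄`, hence on the polar of the normal cone
(`nonneg_of_forall_clarkeNormalCone`). If the inclusion failed, separating the compact convex set of
which `Ψ` is the support function from the negative of the normal cone would yield a direction in
that polar with `Ψ < 0` (`zero_mem_sum_clarkeSubdifferential`). -/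

theorem tendsto_add_smul_nhds_prod_nhdsGT (x d : X) :
    Tendsto (fun q : X × ℝ => q.1 + q.2 • d) (𝓝 x ×ˢ 𝓝[>] (0 : ℝ)) (𝓝 x) := by
  have h : Tendsto (fun q : X × ℝ => q.1 + q.2 • d) (𝓝 (x, (0 : ℝ))) (𝓝 (x + (0 : ℝ) • d)) :=
    Continuous.tendsto (by fun_prop) _
  rw [zero_smul, add_zero, nhds_prod_eq] at h
  exact h.mono_left (Filter.prod_mono le_rfl nhdsWithin_le_nhds)

theorem eventually_snd_pos_nhds_prod_nhdsGT {X : Type*} [TopologicalSpace X] (x : X) :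
    ∀ᶠ q : X × ℝ in 𝓝 x ×ˢ 𝓝[>] (0 : ℝ), 0 < q.2 :=
  tendsto_snd.eventually (eventually_mem_nhdsWithin (s := Set.Ioi (0 : ℝ)))

/-- The difference quotients of a locally Lipschitz function are bounded near the limit. -/
theorem LocallyLipschitz.exists_abs_quotient_le {φ : X → ℝ} (hφ : LocallyLipschitz φ) (x : X) :
    ∃ K : ℝ, 0 ≤ K ∧ ∀ d : X, ∀ᶠ q : X × ℝ in 𝓝 x ×ˢ 𝓝[>] (0 : ℝ),
      |(φ (q.1 + q.2 • d) - φ q.1) / q.2| ≤ K * ‖d‖ := by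
  obtain ⟨K, t, ht, hK⟩ := hφ x
  refine ⟨K, K.2, fun d => ?_⟩
  filter_upwards [tendsto_fst.eventually ht,
    (tendsto_add_smul_nhds_prod_nhdsGT x d).eventually ht,
    eventually_snd_pos_nhds_prod_nhdsGT x] with q h1 h2 h3
  have h := hK.dist_le_mul _ h2 _ h1
  rw [Real.dist_eq, dist_eq_norm, add_sub_cancel_left, norm_smul, Real.norm_of_nonneg h3.le] at h
  rw [abs_div, abs_of_pos h3, div_le_iff₀ h3]
  linarith

/-- A real `limsup` is informative only for bounded functions; this bound and its cobounded
counterpart let eventual inequalities pass to and from the Clarke derivative. -/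
theorem LocallyLipschitz.isBoundedUnder_quotient {φ : X → ℝ} (hφ : LocallyLipschitz φ) (x d : X) :
    (𝓝 x ×ˢ 𝓝[>] (0 : ℝ)).IsBoundedUnder (· ≤ ·)
      (fun q : X × ℝ => (φ (q.1 + q.2 • d) - φ q.1) / q.2) := by
  obtain ⟨K, -, h⟩ := hφ.exists_abs_quotient_le x
  exact ⟨K * ‖d‖, eventually_map.2 ((h d).mono fun q hq => (abs_le.1 hq).2)⟩

theorem LocallyLipschitz.isCoboundedUnder_quotient {φ : X → ℝ} (hφ : LocallyLipschitz φ)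
    (x d : X) : (𝓝 x ×ˢ 𝓝[>] (0 : ℝ)).IsCoboundedUnder (· ≤ ·)
      (fun q : X × ℝ => (φ (q.1 + q.2 • d) - φ q.1) / q.2) := by
  obtain ⟨K, -, h⟩ := hφ.exists_abs_quotient_le x
  exact IsBoundedUnder.isCoboundedUnder_le
    ⟨-(K * ‖d‖), eventually_map.2 ((h d).mono fun q hq => (abs_le.1 hq).1)⟩

theorem eventually_quotient_lt_of_clarkeDirDeriv_lt {φ : X → ℝ} (hφ : LocallyLipschitz φ)
    {x d : X} {a : ℝ} (h : clarkeDirDeriv φ x d < a) :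
    ∀ᶠ q : X × ℝ in 𝓝 x ×ˢ 𝓝[>] (0 : ℝ), (φ (q.1 + q.2 • d) - φ q.1) / q.2 < a :=
  eventually_lt_of_limsup_lt h (hφ.isBoundedUnder_quotient x d)

theorem clarkeDirDeriv_le_of_eventually {φ : X → ℝ} (hφ : LocallyLipschitz φ) {x d : X} {a : ℝ}
    (h : ∀ᶠ q : X × ℝ in 𝓝 x ×ˢ 𝓝[>] (0 : ℝ), (φ (q.1 + q.2 • d) - φ q.1) / q.2 ≤ a) :
    clarkeDirDeriv φ x d ≤ a :=
  limsup_le_of_le (hφ.isCoboundedUnder_quotient x d) h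

/-- The one-sided estimate along a ray that an upper bound of the Clarke derivative gives. -/
theorem eventually_ray_lt_of_clarkeDirDeriv_lt {φ : X → ℝ} (hφ : LocallyLipschitz φ)
    {x d : X} {a : ℝ} (h : clarkeDirDeriv φ x d < a) :
    ∀ᶠ t : ℝ in 𝓝[>] (0 : ℝ), φ (x + t • d) < φ x + t * a := by
  have h1 : Tendsto (fun t : ℝ => (x, t)) (𝓝[>] (0 : ℝ)) (𝓝 x ×ˢ 𝓝[>] (0 : ℝ)) :=
    tendsto_const_nhds.prodMk tendsto_id
  filter_upwards [h1.eventually (eventually_quotient_lt_of_clarkeDirDeriv_lt hφ h),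
    eventually_mem_nhdsWithin (s := Set.Ioi (0 : ℝ))] with t ht ht0
  have := (div_lt_iff₀ (Set.mem_Ioi.1 ht0)).1 ht
  linarith

/-- The increment along `d + e` splits at the intermediate point `y + t d`, which still tends to
`x`; the moving base point in the limsup absorbs it. -/
theorem clarkeDirDeriv_add_le {φ : X → ℝ} (hφ : LocallyLipschitz φ) (x d e : X) :
    clarkeDirDeriv φ x (d + e) ≤ clarkeDirDeriv φ x d + clarkeDirDeriv φ x e := by
  refine le_of_forall_pos_le_add fun ε hε => clarkeDirDeriv_le_of_eventually hφ ?_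
  have h1 := eventually_quotient_lt_of_clarkeDirDeriv_lt hφ
    (show clarkeDirDeriv φ x d < clarkeDirDeriv φ x d + ε / 2 by linarith)
  have h2 := eventually_quotient_lt_of_clarkeDirDeriv_lt hφ
    (show clarkeDirDeriv φ x e < clarkeDirDeriv φ x e + ε / 2 by linarith)
  have h3 : Tendsto (fun q : X × ℝ => (q.1 + q.2 • d, q.2)) (𝓝 x ×ˢ 𝓝[>] (0 : ℝ))
      (𝓝 x ×ˢ 𝓝[>] (0 : ℝ)) :=
    (tendsto_add_smul_nhds_prod_nhdsGT x d).prodMk tendsto_snd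
  filter_upwards [h1, h3.eventually h2] with q hq1 hq2
  have h4 : (φ (q.1 + q.2 • (d + e)) - φ q.1) / q.2
      = (φ (q.1 + q.2 • d) - φ q.1) / q.2
        + (φ (q.1 + q.2 • d + q.2 • e) - φ (q.1 + q.2 • d)) / q.2 := by
    rw [smul_add, ← add_assoc, ← add_div]
    congr 1
    ring
  linarith

theorem clarkeDirDeriv_smul_le {φ : X → ℝ} (hφ : LocallyLipschitz φ) (x d : X) {c : ℝ}
    (hc : 0 < c) : clarkeDirDeriv φ x (c • d) ≤ c * clarkeDirDeriv φ x d := by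
  refine le_of_forall_pos_le_add fun ε hε => clarkeDirDeriv_le_of_eventually hφ ?_
  have h1 := eventually_quotient_lt_of_clarkeDirDeriv_lt hφ
    (show clarkeDirDeriv φ x d < clarkeDirDeriv φ x d + ε / c by
      have := div_pos hε hc
      linarith)
  have h2 : Tendsto (fun t : ℝ => t * c) (𝓝[>] (0 : ℝ)) (𝓝[>] (0 : ℝ)) := by
    refine tendsto_nhdsWithin_iff.2 ⟨?_, ?_⟩
    · have : Tendsto (fun t : ℝ => t * c) (𝓝 0) (𝓝 (0 * c)) := Continuous.tendsto (by fun_prop) _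
      rw [zero_mul] at this
      exact this.mono_left nhdsWithin_le_nhds
    · filter_upwards [eventually_mem_nhdsWithin (s := Set.Ioi (0 : ℝ))] with t ht
      exact mul_pos ht hc
  have h3 : Tendsto (fun q : X × ℝ => (q.1, q.2 * c)) (𝓝 x ×ˢ 𝓝[>] (0 : ℝ))
      (𝓝 x ×ˢ 𝓝[>] (0 : ℝ)) := tendsto_fst.prodMk (h2.comp tendsto_snd)
  filter_upwards [h3.eventually h1, eventually_snd_pos_nhds_prod_nhdsGT x] with q hq hq0
  have h4 : (φ (q.1 + q.2 • c • d) - φ q.1) / q.2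
      = c * ((φ (q.1 + (q.2 * c) • d) - φ q.1) / (q.2 * c)) := by
    rw [smul_smul]
    field_simp
  rw [h4]
  have h5 := mul_le_mul_of_nonneg_left hq.le hc.le
  rw [mul_add, mul_div_cancel₀ _ hc.ne'] at h5
  exact h5

theorem clarkeDirDeriv_smul {φ : X → ℝ} (hφ : LocallyLipschitz φ) (x d : X) {c : ℝ}
    (hc : 0 < c) : clarkeDirDeriv φ x (c • d) = c * clarkeDirDeriv φ x d := by
  refine le_antisymm (clarkeDirDeriv_smul_le hφ x d hc) ?_
  have h := clarkeDirDeriv_smul_le hφ x (c • d) (inv_pos.2 hc)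
  rw [smul_smul, inv_mul_cancel₀ hc.ne', one_smul] at h
  have h2 := mul_le_mul_of_nonneg_left h hc.le
  rwa [← mul_assoc, mul_inv_cancel₀ hc.ne', one_mul] at h2

theorem clarkeDirDeriv_zero {φ : X → ℝ} (hφ : LocallyLipschitz φ) (x : X) :
    clarkeDirDeriv φ x 0 = 0 := by
  have h := clarkeDirDeriv_smul hφ x 0 (c := 2) two_pos
  rw [smul_zero] at h
  linarith

theorem exists_clarkeDirDeriv_le {φ : X → ℝ} (hφ : LocallyLipschitz φ) (x : X) :
    ∃ K : ℝ, 0 ≤ K ∧ ∀ d : X, clarkeDirDeriv φ x d ≤ K * ‖d‖ := by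
  obtain ⟨K, hK, h⟩ := hφ.exists_abs_quotient_le x
  exact ⟨K, hK, fun d => clarkeDirDeriv_le_of_eventually hφ
    ((h d).mono fun q hq => (abs_le.1 hq).2)⟩

theorem continuous_clarkeDirDeriv {φ : X → ℝ} (hφ : LocallyLipschitz φ) (x : X) :
    Continuous (clarkeDirDeriv φ x) := by
  obtain ⟨K, -, h⟩ := exists_clarkeDirDeriv_le hφ x
  refine (LipschitzWith.of_le_add_mul' K fun d e => ?_).continuous
  have h1 := clarkeDirDeriv_add_le hφ x e (d - e)
  rw [add_sub_cancel] at h1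
  have h2 := h (d - e)
  rw [dist_eq_norm]
  linarith

theorem convexOn_clarkeDirDeriv {φ : X → ℝ} (hφ : LocallyLipschitz φ) (x : X) :
    ConvexOn ℝ Set.univ (clarkeDirDeriv φ x) := by
  refine convexOn_iff_forall_pos.2 ⟨convex_univ, fun d _ e _ a b ha hb _ => ?_⟩
  have h := clarkeDirDeriv_add_le hφ x (a • d) (b • e)
  rwa [clarkeDirDeriv_smul hφ x d ha, clarkeDirDeriv_smul hφ x e hb] at h

theorem convex_clarkeSubdifferential (φ : X → ℝ) (x : X) :
    Convex ℝ (clarkeSubdifferential φ x) := by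
  intro u hu v hv a b ha hb hab d
  have h1 := mul_le_mul_of_nonneg_left (hu d) ha
  have h2 := mul_le_mul_of_nonneg_left (hv d) hb
  have h3 : a * clarkeDirDeriv φ x d + b * clarkeDirDeriv φ x d = clarkeDirDeriv φ x d := by
    rw [← add_mul, hab, one_mul]
  simp only [add_apply, smul_apply, smul_eq_mul]
  linarith

theorem isClosed_clarkeSubdifferential (φ : X → ℝ) (x : X) :
    IsClosed (clarkeSubdifferential φ x) := by
  rw [clarkeSubdifferential, Set.ofPred_forall]
  exact isClosed_iInter fun d =>
    isClosed_le (ContinuousLinearMap.apply ℝ ℝ d).continuous continuous_const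

theorem isCompact_clarkeSubdifferential [FiniteDimensional ℝ X] {φ : X → ℝ}
    (hφ : LocallyLipschitz φ) (x : X) : IsCompact (clarkeSubdifferential φ x) := by
  obtain ⟨K, hK, h⟩ := exists_clarkeDirDeriv_le hφ x
  have : ProperSpace (StrongDual ℝ X) := FiniteDimensional.proper ℝ _
  refine Metric.isCompact_of_isClosed_isBounded (isClosed_clarkeSubdifferential φ x)
    ((Metric.isBounded_closedBall (x := (0 : StrongDual ℝ X)) (r := K)).subset fun u hu => ?_)
  rw [mem_closedBall_zero_iff]
  refine u.opNorm_le_bound hK fun d => ?_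
  rw [Real.norm_eq_abs, abs_le]
  refine ⟨?_, (hu d).trans (h d)⟩
  have h1 := (hu (-d)).trans (h (-d))
  rw [map_neg, norm_neg] at h1
  linarith

/-- The Clarke derivative is the support function of the Clarke subdifferential. -/
theorem exists_mem_clarkeSubdifferential_eq [FiniteDimensional ℝ X] {φ : X → ℝ}
    (hφ : LocallyLipschitz φ) (x d : X) :
    ∃ u ∈ clarkeSubdifferential φ x, u d = clarkeDirDeriv φ x d := by
  -- Hahn–Banach for the sublinear Clarke derivative; continuity of the extension is automatic in
  -- finite dimension.
  have key : ∀ g : X →ₗ.[ℝ] ℝ, (∀ y : g.domain, g y ≤ clarkeDirDeriv φ x y) →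
      ∃ u ∈ clarkeSubdifferential φ x, ∀ y : g.domain, u y = g y := by
    intro g hg
    obtain ⟨u, hu1, hu2⟩ := exists_extension_of_le_sublinear g (clarkeDirDeriv φ x)
      (fun c hc y => clarkeDirDeriv_smul hφ x y hc) (clarkeDirDeriv_add_le hφ x) hg
    exact ⟨LinearMap.toContinuousLinearMap u, hu2, hu1⟩
  rcases eq_or_ne d 0 with rfl | hd
  · obtain ⟨u, hu, -⟩ := key ⟨⊥, 0⟩ fun y => by
      obtain ⟨y, hy⟩ := y
      obtain rfl := (Submodule.mem_bot ℝ).1 hy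
      exact (clarkeDirDeriv_zero hφ x).ge
    exact ⟨u, hu, by rw [map_zero, clarkeDirDeriv_zero hφ x]⟩
  · obtain ⟨u, hu, h⟩ := key (LinearPMap.mkSpanSingleton d (clarkeDirDeriv φ x d) hd) fun y => by
      obtain ⟨y, hy⟩ := y
      obtain ⟨c, rfl⟩ := Submodule.mem_span_singleton.1 hy
      rw [LinearPMap.mkSpanSingleton'_apply, RingHom.id_apply, smul_eq_mul]
      rcases lt_trichotomy c 0 with hc | rfl | hc
      · have h1 := clarkeDirDeriv_add_le hφ x (c • d) ((-c) • d)
        rw [← add_smul, add_neg_cancel, zero_smul, clarkeDirDeriv_zero hφ,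
          clarkeDirDeriv_smul hφ x d (neg_pos.2 hc)] at h1
        simp only
        linarith
      · simp [clarkeDirDeriv_zero hφ]
      · exact (clarkeDirDeriv_smul hφ x d hc).ge
    refine ⟨u, hu, ?_⟩
    have h1 := h ⟨d, Submodule.mem_span_singleton_self d⟩
    rwa [LinearPMap.mkSpanSingleton_apply] at h1

/-- Along a Clarke tangent direction, the distance to the set is `o(t)`. -/
theorem eventually_exists_mem_of_mem_clarkeTangentCone {S : Set X} {x v : X} (hx : x ∈ S)
    (hv : v ∈ clarkeTangentCone S x) {ε : ℝ} (hε : 0 < ε) :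
    ∀ᶠ t : ℝ in 𝓝[>] (0 : ℝ), ∃ y ∈ S, ‖x + t • v - y‖ < t * ε := by
  have hlip : LocallyLipschitz fun y => Metric.infDist y S :=
    (Metric.lipschitz_infDist_pt S).locallyLipschitz
  have hv0 : clarkeDirDeriv (fun y => Metric.infDist y S) x v < ε := by
    have h0 : clarkeDirDeriv (fun y => Metric.infDist y S) x v = 0 := hv
    rwa [h0]
  filter_upwards [eventually_ray_lt_of_clarkeDirDeriv_lt hlip hv0] with t ht
  rw [Metric.infDist_zero_of_mem hx, zero_add, Metric.infDist_lt_iff ⟨x, hx⟩] at ht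
  simpa only [dist_eq_norm] using ht

/-- Clarke tangent vectors are limits of feasible directions. -/
theorem exists_smul_sub_near_of_mem_clarkeTangentCone {S : Set X} {x v : X} (hx : x ∈ S)
    (hv : v ∈ clarkeTangentCone S x) {ε : ℝ} (hε : 0 < ε) :
    ∃ c : ℝ, 0 < c ∧ ∃ y ∈ S, ‖v - c • (y - x)‖ < ε := by
  obtain ⟨t, ⟨y, hy, h⟩, ht⟩ := ((eventually_exists_mem_of_mem_clarkeTangentCone hx hv hε).and
    (eventually_mem_nhdsWithin (s := Set.Ioi (0 : ℝ)))).exists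
  have ht : 0 < t := ht
  refine ⟨t⁻¹, inv_pos.2 ht, y, hy, ?_⟩
  have h1 : v - t⁻¹ • (y - x) = t⁻¹ • (x + t • v - y) := by
    rw [show x + t • v - y = t • v - (y - x) by abel, smul_sub t⁻¹ (t • v), smul_smul,
      inv_mul_cancel₀ ht.ne', one_smul]
  rw [h1, norm_smul, Real.norm_of_nonneg (inv_pos.2 ht).le]
  calc t⁻¹ * ‖x + t • v - y‖ < t⁻¹ * (t * ε) := by gcongr
    _ = ε := by rw [← mul_assoc, inv_mul_cancel₀ ht.ne', one_mul]

/-- A continuous positively homogeneous function that is nonnegative on the feasible directions of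
a convex set is nonnegative on the polar of its Clarke normal cone. -/
theorem nonneg_of_forall_clarkeNormalCone {S : Set X} (hS : Convex ℝ S) {x : X} (hx : x ∈ S)
    {Ψ : X → ℝ} (hΨc : Continuous Ψ) (hΨh : ∀ c : ℝ, 0 < c → ∀ d, Ψ (c • d) = c * Ψ d)
    (hΨ : ∀ y ∈ S, 0 ≤ Ψ (y - x)) {d : X} (hd : ∀ u ∈ clarkeNormalCone S x, u d ≤ 0) :
    0 ≤ Ψ d := by
  have hconv : Convex ℝ ((fun y => y - x) '' S) := by
    simpa only [sub_eq_neg_add] using! hS.translate (-x)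
  -- `T` is the cone of feasible directions. On its closure the claim follows by homogeneity and
  -- continuity; a point outside is separated by a functional that turns out to be normal.
  set T := ConvexCone.hull ℝ ((fun y => y - x) '' S) with hT
  have hmem : ∀ e, e ∈ T ↔ ∃ c : ℝ, 0 < c ∧ ∃ y ∈ S, c • (y - x) = e := fun e => by
    rw [hT, ConvexCone.mem_hull_of_convex hconv]
    simp [Set.mem_smul_set]
  by_cases hdT : d ∈ closure (T : Set X)
  · refine closure_minimal ?_ (isClosed_le continuous_const hΨc) hdT
    intro e he
    obtain ⟨c, hc, y, hy, rfl⟩ := (hmem e).1 he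
    show 0 ≤ Ψ (c • (y - x))
    rw [hΨh c hc]
    exact mul_nonneg hc.le (hΨ y hy)
  · obtain ⟨u, a, h1, h2⟩ :=
      geometric_hahn_banach_closed_point T.convex.closure isClosed_closure hdT
    exfalso
    have h0 : (0 : X) ∈ T := (hmem 0).2 ⟨1, one_pos, x, hx, by simp⟩
    have ha : 0 < a := by simpa using h1 0 (subset_closure h0)
    have hle : ∀ y ∈ S, u (y - x) ≤ 0 := by
      intro y hy
      by_contra! hpos
      have h3 := h1 _ (subset_closure ((hmem _).2 ⟨a / u (y - x), div_pos ha hpos, y, hy, rfl⟩))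
      rw [map_smul, smul_eq_mul, div_mul_cancel₀ _ hpos.ne'] at h3
      exact lt_irrefl _ h3
    have hu : u ∈ clarkeNormalCone S x := by
      intro v hv
      by_contra! hpos
      have hu0 : 0 < ‖u‖ + 1 := by positivity
      -- The tolerance `u v / (‖u‖ + 1)` makes the error under `u` smaller than `u v`, while `u` is
      -- nonpositive on feasible directions.
      obtain ⟨c, hc, y, hy, h3⟩ :=
        exists_smul_sub_near_of_mem_clarkeTangentCone hx hv (div_pos hpos hu0)
      have h4 : u v ≤ u (v - c • (y - x)) := by
        rw [map_sub, map_smul, smul_eq_mul]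
        have := mul_nonpos_of_nonneg_of_nonpos hc.le (hle y hy)
        linarith
      have h5 := (le_abs_self _).trans (u.le_opNorm (v - c • (y - x)))
      rw [lt_div_iff₀ hu0] at h3
      nlinarith [norm_nonneg (v - c • (y - x)), norm_nonneg u]
    linarith [hd u hu]

theorem isClosed_clarkeNormalCone (S : Set X) (x : X) : IsClosed (clarkeNormalCone S x) := by
  have : clarkeNormalCone S x = ⋂ v ∈ clarkeTangentCone S x, {u : StrongDual ℝ X | u v ≤ 0} := by
    ext u
    simp [clarkeNormalCone]
  rw [this]
  exact isClosed_biInter fun v _ =>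
    isClosed_le (ContinuousLinearMap.apply ℝ ℝ v).continuous continuous_const

theorem convex_clarkeNormalCone (S : Set X) (x : X) : Convex ℝ (clarkeNormalCone S x) := by
  intro u hu v hv a b ha hb _ d hd
  have h1 := mul_nonpos_of_nonneg_of_nonpos ha (hu d hd)
  have h2 := mul_nonpos_of_nonneg_of_nonpos hb (hv d hd)
  simp only [add_apply, smul_apply, smul_eq_mul]
  linarith

theorem smul_mem_clarkeNormalCone {S : Set X} {x : X} {u : StrongDual ℝ X}
    (hu : u ∈ clarkeNormalCone S x) {c : ℝ} (hc : 0 ≤ c) : c • u ∈ clarkeNormalCone S x :=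
  fun v hv => mul_nonpos_of_nonneg_of_nonpos hc (hu v hv)

theorem isCompact_finset_sum {ι M : Type*} [AddCommMonoid M] [TopologicalSpace M]
    [ContinuousAdd M] (s : Finset ι) (t : ι → Set M) (h : ∀ i ∈ s, IsCompact (t i)) :
    IsCompact (∑ i ∈ s, t i) := by
  classical
  induction s using Finset.induction_on with
  | empty => exact isCompact_singleton
  | insert a s ha ih =>
    rw [Finset.sum_insert ha]
    exact (h a (Finset.mem_insert_self a s)).add
      (ih fun i hi => h i (Finset.mem_insert_of_mem hi))

end ClarkeCalculus

/-! ### From a nonnegative directional form to a subgradient inclusion. -/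

section StationaryPoint

variable {E : Type*} [NormedAddCommGroup E] [NormedSpace ℝ E] [FiniteDimensional ℝ E]

/-- A weighted sum of Clarke derivatives, a linear form and a multiple of the norm that is
nonnegative on the feasible directions of a convex set has zero as a generalized subgradient. -/
theorem zero_mem_sum_clarkeSubdifferential {m : ℕ} {f : Fin m → E → ℝ}
    (hf : ∀ i, LocallyLipschitz (f i)) {S : Set E} (hS : Convex ℝ S) {x : E} (hx : x ∈ S)
    (l : Fin m → ℝ) (w : StrongDual ℝ E) (c : ℝ)
    (h : ∀ y ∈ S, 0 ≤ ∑ i, l i * clarkeDirDeriv (f i) x (y - x) + w (y - x) + c * ‖y - x‖) :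
    (0 : StrongDual ℝ E) ∈ ∑ i, l i • clarkeSubdifferential (f i) x + {w}
      + c • Metric.closedBall (0 : StrongDual ℝ E) 1 + clarkeNormalCone S x := by
  have : ProperSpace (StrongDual ℝ E) := FiniteDimensional.proper ℝ _
  set A : Set (StrongDual ℝ E) := ∑ i, l i • clarkeSubdifferential (f i) x + {w}
      + c • Metric.closedBall (0 : StrongDual ℝ E) 1 with hA
  have hAcompact : IsCompact A :=
    ((isCompact_finset_sum _ _ fun i _ => (isCompact_clarkeSubdifferential (hf i) x).smul (l i)).add
      isCompact_singleton).add ((isCompact_closedBall 0 1).smul c)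
  have hAconvex : Convex ℝ A :=
    ((convex_sum _ fun i _ => (convex_clarkeSubdifferential (f i) x).smul (l i)).add
      (convex_singleton w)).add ((convex_closedBall 0 1).smul c)
  by_contra hnot
  have hdisj : Disjoint A (-clarkeNormalCone S x) := by
    rw [Set.disjoint_left]
    intro a ha hn
    exact hnot (Set.mem_add.2 ⟨a, ha, -a, hn, add_neg_cancel a⟩)
  obtain ⟨L, u, v, h1, h2, h3⟩ := geometric_hahn_banach_compact_closed hAconvex hAcompact
    (convex_clarkeNormalCone S x).neg (isClosed_clarkeNormalCone S x).neg hdisj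
  -- Reflexivity of a finite-dimensional space turns the separating functional on the dual into a
  -- direction.
  obtain ⟨d, hd⟩ : ∃ d : E, ∀ a : StrongDual ℝ E, L a = a d := by
    refine ⟨(Module.evalEquiv ℝ E).symm
      (L.toLinearMap ∘ₗ (LinearMap.toContinuousLinearMap (𝕜 := ℝ) (E := E) (F' := ℝ)).toLinearMap),
      fun a => ?_⟩
    exact (Module.apply_evalEquiv_symm_apply ℝ E a.toLinearMap
      (L.toLinearMap ∘ₗ (LinearMap.toContinuousLinearMap (𝕜 := ℝ) (E := E) (F' := ℝ)).toLinearMap)).symm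
  have hv : v < 0 := by
    have h0 : (0 : StrongDual ℝ E) ∈ -clarkeNormalCone S x := by
      rw [Set.mem_neg, neg_zero]
      exact fun _ _ => le_rfl
    simpa using h3 0 h0
  have hN : ∀ a ∈ clarkeNormalCone S x, a d ≤ 0 := by
    intro a ha
    by_contra! hpos
    -- This multiple of `a` is scaled so that `L` takes exactly the excluded value `v`.
    have h4 := h3 (-((-v / a d) • a)) (by
      rw [Set.neg_mem_neg]
      exact smul_mem_clarkeNormalCone ha (div_pos (neg_pos.2 hv) hpos).le)
    rw [hd, neg_apply, smul_apply, smul_eq_mul,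
      div_mul_cancel₀ _ hpos.ne', neg_neg] at h4
    exact lt_irrefl _ h4
  have hΨ := nonneg_of_forall_clarkeNormalCone hS hx
    (Ψ := fun e => ∑ i, l i * clarkeDirDeriv (f i) x e + w e + c * ‖e‖)
    (by
      have := fun i => continuous_clarkeDirDeriv (hf i) x
      fun_prop)
    (fun b hb e => by
      simp only [fun i => clarkeDirDeriv_smul (hf i) x e hb, map_smul, norm_smul,
        Real.norm_of_nonneg hb.le, smul_eq_mul, mul_add, Finset.mul_sum]
      congr 1
      · congr 1
        exact Finset.sum_congr rfl fun i _ => by ring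
      · ring)
    h hN
  -- Subgradients attaining the Clarke derivatives at `d`, with a norming functional `b`, give a
  -- point of `A` whose value at `d` is `Ψ d`, so `Ψ d < u < v < 0`.
  choose g hg hgd using fun i => exists_mem_clarkeSubdifferential_eq (hf i) x d
  obtain ⟨b, hb, hbd⟩ := exists_dual_vector'' ℝ d
  have hmem : ∑ i, l i • g i + w + c • b ∈ A :=
    Set.add_mem_add (Set.add_mem_add
      (Set.finsetSum_mem_finsetSum _ _ _ fun i _ => Set.smul_mem_smul_set (hg i))
      (Set.mem_singleton w)) (Set.smul_mem_smul_set (mem_closedBall_zero_iff.2 hb))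
  have h5 := h1 _ hmem
  rw [hd] at h5
  simp only [add_apply, sum_apply,
    smul_apply, smul_eq_mul, hgd, hbd, RCLike.ofReal_real_eq_id, id] at h5
  linarith

end StationaryPoint

/-! ### The trace product and positive semidefinite matrices. -/

section TraceProduct

variable {p : ℕ}

theorem traceProd_eq_sum (A B : Matrix (Fin p) (Fin p) ℝ) :
    traceProd A B = ∑ i, ∑ j, A i j * B j i := by
  simp [traceProd, Matrix.trace, Matrix.mul_apply]

theorem traceProd_add_right (A B C : Matrix (Fin p) (Fin p) ℝ) :
    traceProd A (B + C) = traceProd A B + traceProd A C := by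
  rw [traceProd, Matrix.mul_add, Matrix.trace_add, traceProd, traceProd]

theorem traceProd_smul_right (c : ℝ) (A B : Matrix (Fin p) (Fin p) ℝ) :
    traceProd A (c • B) = c * traceProd A B := by
  rw [traceProd, Matrix.mul_smul, Matrix.trace_smul, smul_eq_mul, traceProd]

theorem traceProd_smul_left (c : ℝ) (A B : Matrix (Fin p) (Fin p) ℝ) :
    traceProd (c • A) B = c * traceProd A B := by
  rw [traceProd, Matrix.smul_mul, Matrix.trace_smul, smul_eq_mul, traceProd]

theorem traceProd_neg_right (A B : Matrix (Fin p) (Fin p) ℝ) :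
    traceProd A (-B) = -traceProd A B := by
  rw [traceProd, Matrix.mul_neg, Matrix.trace_neg, traceProd]

theorem traceProd_sum_right {ι : Type*} (s : Finset ι) (A : Matrix (Fin p) (Fin p) ℝ)
    (B : ι → Matrix (Fin p) (Fin p) ℝ) :
    traceProd A (∑ i ∈ s, B i) = ∑ i ∈ s, traceProd A (B i) := by
  simp only [traceProd, Matrix.mul_sum, Matrix.trace_sum]

theorem traceProd_zero_right (A : Matrix (Fin p) (Fin p) ℝ) : traceProd A 0 = 0 := by
  rw [traceProd, Matrix.mul_zero, Matrix.trace_zero]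

theorem traceProd_single (A : Matrix (Fin p) (Fin p) ℝ) (i j : Fin p) :
    traceProd A (Matrix.single i j 1) = A j i := by
  rw [traceProd_eq_sum, Finset.sum_eq_single j, Finset.sum_eq_single i] <;>
    simp +contextual [Matrix.single_apply, eq_comm]

theorem traceProd_vecMulVec_self (v : Fin p → ℝ) (A : Matrix (Fin p) (Fin p) ℝ) :
    traceProd (Matrix.vecMulVec v v) A = v ⬝ᵥ A.mulVec v := by
  rw [traceProd_eq_sum, Finset.sum_comm]
  simp only [dotProduct, Matrix.mulVec, Matrix.vecMulVec_apply, Finset.mul_sum]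
  exact Finset.sum_congr rfl fun i _ => Finset.sum_congr rfl fun j _ => by ring

/-- The trace of `A * B` is the quadratic form of the Hadamard product of `A` and `Bᵀ` at the
all-ones vector, so the Schur product theorem applies. -/
theorem traceProd_nonneg {A B : Matrix (Fin p) (Fin p) ℝ} (hA : A.PosSemidef)
    (hB : B.PosSemidef) : 0 ≤ traceProd A B := by
  have h := (hA.hadamard hB.transpose).dotProduct_mulVec_nonneg (fun _ => 1)
  rw [traceProd_eq_sum]
  simpa [dotProduct, Matrix.mulVec] using h

/-- Normalized rank-one matrices let a bound on the scalar function `G` control every quadratic form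
`v ⬝ᵥ g(x) v`. -/
theorem smul_vecMulVec_mem_unitPosSemidef {v : Fin p → ℝ} (hv : v ≠ 0) :
    (v ⬝ᵥ v)⁻¹ • Matrix.vecMulVec v v ∈ unitPosSemidef p := by
  have h0 : v ⬝ᵥ v ≠ 0 := fun h => hv (dotProduct_self_eq_zero.1 h)
  have h1 : 0 ≤ v ⬝ᵥ v := Finset.sum_nonneg fun i _ => mul_self_nonneg (v i)
  refine ⟨?_, ?_⟩
  · have := (Matrix.posSemidef_vecMulVec_self_star v).smul (inv_nonneg.2 h1)
    simpa using this
  · rw [traceProd_smul_left, traceProd_smul_right, traceProd_vecMulVec_self,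
      Matrix.vecMulVec_mulVec, op_smul_eq_smul, dotProduct_smul, smul_eq_mul]
    field_simp

theorem abs_traceProd_le_of_mem_unitPosSemidef {Λ : Matrix (Fin p) (Fin p) ℝ}
    (hΛ : Λ ∈ unitPosSemidef p) (A : Matrix (Fin p) (Fin p) ℝ) :
    |traceProd Λ A| ≤ ∑ i, ∑ j, |A j i| := by
  have h1 : ∑ i, ∑ j, Λ i j ^ 2 = 1 := by
    rw [← hΛ.2, traceProd_eq_sum]
    refine Finset.sum_congr rfl fun i _ => Finset.sum_congr rfl fun j _ => ?_
    rw [sq, show Λ j i = Λ i j by simpa using hΛ.1.isHermitian.apply i j]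
  have h2 : ∀ i j, |Λ i j| ≤ 1 := by
    intro i j
    rw [← sq_le_one_iff_abs_le_one, ← h1]
    exact (Finset.single_le_sum (f := fun j => Λ i j ^ 2) (fun j _ => sq_nonneg _)
      (Finset.mem_univ j)).trans (Finset.single_le_sum (f := fun i => ∑ j, Λ i j ^ 2)
        (fun i _ => Finset.sum_nonneg fun j _ => sq_nonneg _) (Finset.mem_univ i))
  rw [traceProd_eq_sum]
  refine (Finset.abs_sum_le_sum_abs _ _).trans (Finset.sum_le_sum fun i _ =>
    (Finset.abs_sum_le_sum_abs _ _).trans (Finset.sum_le_sum fun j _ => ?_))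
  rw [abs_mul]
  exact mul_le_of_le_one_left (abs_nonneg _) (h2 i j)

/-- Matrices with a positive definite quadratic form, symmetric or not, form an open set. -/
theorem isOpen_setOf_dotProduct_mulVec_pos :
    IsOpen {A : Matrix (Fin p) (Fin p) ℝ | ∀ v : Fin p → ℝ, v ≠ 0 → 0 < v ⬝ᵥ A.mulVec v} := by
  -- Homogeneity reduces to the unit sphere, whose compactness makes the neighbourhood of `A`
  -- uniform in `v`.
  have h : {A : Matrix (Fin p) (Fin p) ℝ | ∀ v : Fin p → ℝ, v ≠ 0 → 0 < v ⬝ᵥ A.mulVec v}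
      = {A | ∀ v ∈ Metric.sphere (0 : Fin p → ℝ) 1, 0 < v ⬝ᵥ A.mulVec v} := by
    ext A
    refine ⟨fun h v hv => h v (Metric.ne_of_mem_sphere hv one_ne_zero), fun h v hv => ?_⟩
    have h0 : 0 < ‖v‖⁻¹ := inv_pos.2 (norm_pos_iff.2 hv)
    have h1 := h (‖v‖⁻¹ • v) (by
      rw [mem_sphere_zero_iff_norm, norm_smul, norm_inv, norm_norm,
        inv_mul_cancel₀ (norm_ne_zero_iff.2 hv)])
    rw [Matrix.mulVec_smul, smul_dotProduct, dotProduct_smul, smul_eq_mul, smul_eq_mul] at h1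
    exact pos_of_mul_pos_right (pos_of_mul_pos_right h1 h0.le) h0.le
  rw [h, isOpen_iff_mem_nhds]
  intro A hA
  refine (isCompact_sphere (0 : Fin p → ℝ) 1).eventually_forall_of_forall_eventually fun v hv => ?_
  have hc : Continuous fun z : Matrix (Fin p) (Fin p) ℝ × (Fin p → ℝ) => z.2 ⬝ᵥ z.1.mulVec z.2 := by
    fun_prop
  exact hc.continuousAt.eventually (lt_mem_nhds (hA v hv))

end TraceProduct

/-! ### Theorem of the alternative by separation. -/

section Alternative

variable {m p : ℕ}

/-- A linear functional on pairs of a vector and a matrix, in coordinates. -/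
theorem exists_linearMap_prod_matrix_eq (L : (Fin m → ℝ) × Matrix (Fin p) (Fin p) ℝ →ₗ[ℝ] ℝ) :
    ∃ (l : Fin m → ℝ) (Λ : Matrix (Fin p) (Fin p) ℝ),
      ∀ r A, L (r, A) = ∑ i, l i * r i + traceProd Λ A := by
  refine ⟨fun i => L (fun j => if i = j then 1 else 0, 0),
    Matrix.of fun j i => L (0, Matrix.single i j 1), fun r A => ?_⟩
  have h1 : L (r, A) = (L ∘ₗ LinearMap.inl ℝ _ _) r + (L ∘ₗ LinearMap.inr ℝ _ _) A := by
    simp [← map_add]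
  rw [h1]
  congr 1
  · rw [LinearMap.pi_apply_eq_sum_univ]
    simp [mul_comm]
  · rw [traceProd_eq_sum, Finset.sum_comm]
    conv_lhs => rw [Matrix.matrix_eq_sum_single A]
    simp only [map_sum]
    refine Finset.sum_congr rfl fun i _ => Finset.sum_congr rfl fun j _ => ?_
    rw [show Matrix.single i j (A i j) = A i j • Matrix.single i j (1 : ℝ) by
      rw [Matrix.smul_single, smul_eq_mul, mul_one], map_smul, smul_eq_mul, mul_comm]
    rfl

/-- A theorem of the alternative for finitely many convex inequalities and one affine
semidefinite inequality, under the Slater condition for the latter. -/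
theorem exists_multipliers_of_not_exists_lt {V : Type*} [AddCommGroup V] [Module ℝ V] {S : Set V}
    {h : Fin m → V → ℝ} (hh : ∀ i, ConvexOn ℝ S (h i)) (hS : Convex ℝ S)
    {g : V → Matrix (Fin p) (Fin p) ℝ}
    (hg : ∀ x y : V, ∀ a b : ℝ, a + b = 1 → g (a • x + b • y) = a • g x + b • g y)
    (hno : ¬ ∃ y ∈ S, (∀ i, h i y < 0) ∧ ∀ v : Fin p → ℝ, v ≠ 0 → v ⬝ᵥ (g y).mulVec v < 0)
    (hslater : ∃ y ∈ S, ∀ v : Fin p → ℝ, v ≠ 0 → v ⬝ᵥ (g y).mulVec v < 0) :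
    ∃ l : Fin m → ℝ, (∀ i, 0 ≤ l i) ∧ ∑ i, l i = 1 ∧
      ∃ Λ : Matrix (Fin p) (Fin p) ℝ, Λ.PosSemidef ∧
        ∀ y ∈ S, 0 ≤ ∑ i, l i * h i y + traceProd Λ (g y) := by
  -- Nonsymmetric matrices are admitted so that `Q` is open in the full matrix space; symmetry of
  -- `Λ` is recovered later.
  set Q : Set ((Fin m → ℝ) × Matrix (Fin p) (Fin p) ℝ) :=
    {z | ∃ y ∈ S, (∀ i, h i y < z.1 i) ∧
      ∀ v : Fin p → ℝ, v ≠ 0 → 0 < v ⬝ᵥ (z.2 - g y).mulVec v} with hQ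
  have hQopen : IsOpen Q := by
    have : Q = ⋃ y ∈ S, (⋂ i, {z | h i y < z.1 i}) ∩ (fun z => z.2 - g y) ⁻¹'
        {A : Matrix (Fin p) (Fin p) ℝ | ∀ v : Fin p → ℝ, v ≠ 0 → 0 < v ⬝ᵥ A.mulVec v} := by
      ext z
      simp only [hQ, Set.mem_ofPred_eq, Set.mem_iUnion, Set.mem_inter_iff, Set.mem_iInter,
        Set.mem_preimage, exists_prop]
    rw [this]
    refine isOpen_biUnion fun y _ => IsOpen.inter (isOpen_iInter_of_finite fun i => ?_) ?_
    · exact isOpen_lt continuous_const (by fun_prop)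
    · exact isOpen_setOf_dotProduct_mulVec_pos.preimage (by fun_prop)
  have hQconvex : Convex ℝ Q := by
    refine convex_iff_forall_pos.2 ?_
    rintro z ⟨y, hy, h1, h2⟩ z' ⟨y', hy', h1', h2'⟩ a b ha hb hab
    refine ⟨a • y + b • y', hS hy hy' ha.le hb.le hab, fun i => ?_, fun v hv => ?_⟩
    · have h3 := (hh i).2 hy hy' ha.le hb.le hab
      have h4 := mul_lt_mul_of_pos_left (h1 i) ha
      have h5 := mul_lt_mul_of_pos_left (h1' i) hb
      simp only [smul_eq_mul] at h3
      simp only [Prod.fst_add, Prod.smul_fst, Pi.add_apply, Pi.smul_apply, smul_eq_mul]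
      linarith
    · have h3 : (a • z + b • z').2 - g (a • y + b • y')
          = a • (z.2 - g y) + b • (z'.2 - g y') := by
        rw [hg _ _ _ _ hab, Prod.snd_add, Prod.smul_snd, Prod.smul_snd, smul_sub, smul_sub]
        abel
      rw [h3, Matrix.add_mulVec, Matrix.smul_mulVec, Matrix.smul_mulVec, dotProduct_add,
        dotProduct_smul, dotProduct_smul]
      exact add_pos (mul_pos ha (h2 v hv)) (mul_pos hb (h2' v hv))
  have hQ0 : (0 : (Fin m → ℝ) × Matrix (Fin p) (Fin p) ℝ) ∉ Q := by
    rintro ⟨y, hy, h1, h2⟩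
    refine hno ⟨y, hy, h1, fun v hv => ?_⟩
    simpa [Matrix.neg_mulVec] using h2 v hv
  obtain ⟨L, hL⟩ := geometric_hahn_banach_point_open hQconvex hQopen hQ0
  obtain ⟨l, Λ, hlΛ⟩ := exists_linearMap_prod_matrix_eq L.toLinearMap
  replace hL : ∀ r A, (r, A) ∈ Q → 0 < ∑ i, l i * r i + traceProd Λ A := by
    intro r A hrA
    have := hL _ hrA
    rw [map_zero] at this
    exact this.trans_eq (hlΛ r A)
  -- Points `(h y + r, g y + P)` are limits of points of `Q`: add `ε` to each coordinate and `ε • 1`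
  -- to the matrix, then let `ε` shrink.
  have hshift : ∀ y ∈ S, ∀ r : Fin m → ℝ, (∀ i, 0 ≤ r i) → ∀ P : Matrix (Fin p) (Fin p) ℝ,
      (∀ v : Fin p → ℝ, 0 ≤ v ⬝ᵥ P.mulVec v) →
      0 ≤ (∑ i, l i * h i y + traceProd Λ (g y)) + (∑ i, l i * r i + traceProd Λ P) := by
    intro y hy r hr P hP
    have hmem : ∀ ε : ℝ, 0 < ε →
        0 < (∑ i, l i * h i y + traceProd Λ (g y)) + (∑ i, l i * r i + traceProd Λ P)
          + ε * (∑ i, l i + traceProd Λ 1) := by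
      intro ε hε
      have h1 := hL (fun i => h i y + r i + ε) (g y + P + ε • 1)
        ⟨y, hy, fun i => by linarith [hr i], fun v hv => by
          rw [add_assoc, add_sub_cancel_left, Matrix.add_mulVec, Matrix.smul_mulVec,
            Matrix.one_mulVec, dotProduct_add, dotProduct_smul]
          refine add_pos_of_nonneg_of_pos (hP v) (mul_pos hε ?_)
          exact lt_of_le_of_ne (Finset.sum_nonneg fun i _ => mul_self_nonneg (v i))
            fun h => hv (dotProduct_self_eq_zero.1 h.symm)⟩
      simp only [traceProd_add_right, traceProd_smul_right, mul_add, Finset.sum_add_distrib,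
        ← Finset.sum_mul] at h1
      linarith
    by_contra! hneg
    set a := (∑ i, l i * h i y + traceProd Λ (g y)) + (∑ i, l i * r i + traceProd Λ P)
    set b := ∑ i, l i + traceProd Λ 1
    have hb : 0 < |b| + 1 := by positivity
    have h2 := hmem (-a / (|b| + 1)) (div_pos (neg_pos.2 hneg) hb)
    have h3 : -a / (|b| + 1) * b ≤ -a / (|b| + 1) * (|b| + 1) :=
      mul_le_mul_of_nonneg_left (by linarith [le_abs_self b]) (div_pos (neg_pos.2 hneg) hb).le
    rw [div_mul_cancel₀ _ hb.ne'] at h3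
    linarith
  obtain ⟨y₀, hy₀, hy₀neg⟩ := hslater
  have hcone : ∀ r : Fin m → ℝ, (∀ i, 0 ≤ r i) → ∀ P : Matrix (Fin p) (Fin p) ℝ,
      (∀ v : Fin p → ℝ, 0 ≤ v ⬝ᵥ P.mulVec v) → 0 ≤ ∑ i, l i * r i + traceProd Λ P := by
    intro r hr P hP
    by_contra! hneg
    set a := ∑ i, l i * h i y₀ + traceProd Λ (g y₀)
    set b := ∑ i, l i * r i + traceProd Λ P with hb
    -- Scaling `(r, P)` by this factor contributes `-(|a| + 1)`, which outweighs `a`.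
    have ht : 0 ≤ (|a| + 1) / -b := (div_pos (by positivity) (neg_pos.2 hneg)).le
    have h1 := hshift y₀ hy₀ (fun i => (|a| + 1) / -b * r i) (fun i => mul_nonneg ht (hr i))
      (((|a| + 1) / -b) • P) fun v => by
        rw [Matrix.smul_mulVec, dotProduct_smul]
        exact mul_nonneg ht (hP v)
    have h2 : ∑ i, l i * ((|a| + 1) / -b * r i) + traceProd Λ (((|a| + 1) / -b) • P)
        = (|a| + 1) / -b * b := by
      rw [traceProd_smul_right, hb, mul_add, Finset.mul_sum]
      congr 1
      exact Finset.sum_congr rfl fun i _ => by ring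
    have h3 : (|a| + 1) / -b * b = -(|a| + 1) := by
      rw [div_neg, neg_mul, div_mul_cancel₀ _ hneg.ne]
    rw [h2, h3] at h1
    linarith [le_abs_self a]
  have hl : ∀ i, 0 ≤ l i := by
    intro i
    simpa [traceProd, Pi.single_apply] using hcone (Pi.single i 1) (fun j => by
      rw [Pi.single_apply]
      split_ifs <;> norm_num) 0 (by simp)
  have hlsum : 0 < ∑ i, l i := by
    refine lt_of_le_of_ne (Finset.sum_nonneg fun i _ => hl i) fun h0 => ?_
    have hl0 : ∀ i, l i = 0 := fun i =>
      (Finset.sum_eq_zero_iff_of_nonneg fun i _ => hl i).1 h0.symm i (Finset.mem_univ i)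
    -- Strict feasibility of `y₀` allows matrix part `0` in `Q`; with `l = 0` the functional would
    -- vanish there.
    have h1 := hL (fun i => h i y₀ + 1) 0 ⟨y₀, hy₀, fun i => by simp, fun v hv => by
      simpa [Matrix.neg_mulVec] using hy₀neg v hv⟩
    simp [hl0, traceProd] at h1
  have hΛ : Λ.PosSemidef := by
    -- Skew matrices have zero quadratic form, so they are admissible perturbations with either
    -- sign.
    have hsym : ∀ i j, Λ i j ≤ Λ j i := by
      intro i j
      have h1 := hcone 0 (fun _ => le_rfl) (Matrix.single i j 1 - Matrix.single j i 1) fun v => by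
        rw [← traceProd_vecMulVec_self, sub_eq_add_neg, traceProd_add_right, traceProd_neg_right,
          traceProd_single, traceProd_single, Matrix.vecMulVec_apply, Matrix.vecMulVec_apply,
          mul_comm (v j), add_neg_cancel]
      simp only [Pi.zero_apply, mul_zero, Finset.sum_const_zero, zero_add, sub_eq_add_neg,
        traceProd_add_right, traceProd_neg_right, traceProd_single] at h1
      linarith
    refine .of_dotProduct_mulVec_nonneg
      (Matrix.IsHermitian.ext fun i j => le_antisymm (hsym j i) (hsym i j)) fun v => ?_
    have h1 := hcone 0 (fun _ => le_rfl) (Matrix.vecMulVec v v) fun w => by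
      rw [Matrix.vecMulVec_mulVec, op_smul_eq_smul, dotProduct_smul, smul_eq_mul,
        dotProduct_comm]
      exact mul_self_nonneg _
    rw [traceProd, Matrix.trace_mul_comm, ← traceProd, traceProd_vecMulVec_self] at h1
    simpa using h1
  refine ⟨fun i => (∑ i, l i)⁻¹ * l i, fun i => mul_nonneg (inv_nonneg.2 hlsum.le) (hl i), ?_,
    (∑ i, l i)⁻¹ • Λ, hΛ.smul (inv_nonneg.2 hlsum.le), fun y hy => ?_⟩
  · rw [← Finset.mul_sum, inv_mul_cancel₀ hlsum.ne']
  · have h1 := hshift y hy 0 (fun _ => le_rfl) 0 (by simp)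
    simp only [Pi.zero_apply, mul_zero, Finset.sum_const_zero, traceProd_zero_right,
      add_zero] at h1
    simp only [traceProd_smul_left, mul_assoc, ← Finset.mul_sum, ← mul_add]
    exact mul_nonneg (inv_nonneg.2 hlsum.le) h1

end Alternative

/-! ### The affine semidefinite constraint and feasible descent. -/

section SemidefiniteConstraint

variable {n p : ℕ}

theorem traceProdVec_apply (Λ : Matrix (Fin p) (Fin p) ℝ) (F : Fin n → Matrix (Fin p) (Fin p) ℝ)
    (d : EuclideanSpace ℝ (Fin n)) : traceProdVec Λ F d = ∑ i, d i * traceProd Λ (F i) := by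
  rw [traceProdVec, InnerProductSpace.toDual_apply_apply, PiLp.inner_apply]
  simp

theorem traceProd_affineMatrixMap (Λ F₀ : Matrix (Fin p) (Fin p) ℝ)
    (F : Fin n → Matrix (Fin p) (Fin p) ℝ) (x : EuclideanSpace ℝ (Fin n)) :
    traceProd Λ (affineMatrixMap F₀ F x) = traceProd Λ F₀ + traceProdVec Λ F x := by
  rw [affineMatrixMap, traceProd_add_right, traceProd_sum_right, traceProdVec_apply]
  simp only [traceProd_smul_right]

theorem affineMatrixMap_add_smul (F₀ : Matrix (Fin p) (Fin p) ℝ)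
    (F : Fin n → Matrix (Fin p) (Fin p) ℝ) (x y : EuclideanSpace ℝ (Fin n)) {a b : ℝ}
    (hab : a + b = 1) : affineMatrixMap F₀ F (a • x + b • y)
      = a • affineMatrixMap F₀ F x + b • affineMatrixMap F₀ F y := by
  have h : F₀ = a • F₀ + b • F₀ := by rw [← add_smul, hab, one_smul]
  simp only [affineMatrixMap, smul_add, Finset.smul_sum, PiLp.add_apply, PiLp.smul_apply,
    smul_eq_mul, add_smul, Finset.sum_add_distrib, smul_smul]
  nth_rewrite 1 [h]
  abel

theorem isHermitian_affineMatrixMap {F₀ : Matrix (Fin p) (Fin p) ℝ}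
    {F : Fin n → Matrix (Fin p) (Fin p) ℝ} (hF₀ : F₀.IsSymm) (hF : ∀ i, (F i).IsSymm)
    (x : EuclideanSpace ℝ (Fin n)) : (affineMatrixMap F₀ F x).IsHermitian := by
  show Matrix.conjTranspose _ = _
  rw [Matrix.conjTranspose_eq_transpose_of_trivial, affineMatrixMap, Matrix.transpose_add,
    Matrix.transpose_sum, hF₀.eq]
  simp only [Matrix.transpose_smul, fun i => (hF i).eq]

theorem exists_norm_traceProdVec_le (F : Fin n → Matrix (Fin p) (Fin p) ℝ) :
    ∃ M : ℝ, 0 ≤ M ∧ ∀ Λ ∈ unitPosSemidef p, ‖traceProdVec Λ F‖ ≤ M := by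
  have h0 : 0 ≤ ∑ k, ∑ i, ∑ j, |F k j i| := by positivity
  refine ⟨_, h0, fun Λ hΛ => ContinuousLinearMap.opNorm_le_bound _ h0 fun d => ?_⟩
  rw [traceProdVec_apply, Finset.sum_mul]
  refine (norm_sum_le _ _).trans (Finset.sum_le_sum fun k _ => ?_)
  rw [norm_mul, mul_comm]
  exact mul_le_mul (abs_traceProd_le_of_mem_unitPosSemidef hΛ (F k)) (PiLp.norm_apply_le d k)
    (norm_nonneg _) (by positivity)

theorem bddAbove_image_traceProd (A : Matrix (Fin p) (Fin p) ℝ) :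
    BddAbove ((fun Λ => traceProd Λ A) '' unitPosSemidef p) := by
  refine ⟨∑ i, ∑ j, |A j i|, ?_⟩
  rintro _ ⟨Λ, hΛ, rfl⟩
  exact (le_abs_self _).trans (abs_traceProd_le_of_mem_unitPosSemidef hΛ A)

theorem traceProd_le_sdConstraintMax
    (g : EuclideanSpace ℝ (Fin n) → Matrix (Fin p) (Fin p) ℝ) {Λ : Matrix (Fin p) (Fin p) ℝ}
    (hΛ : Λ ∈ unitPosSemidef p) (x : EuclideanSpace ℝ (Fin n)) :
    traceProd Λ (g x) ≤ sdConstraintMax g x :=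
  le_csSup (bddAbove_image_traceProd (g x)) ⟨Λ, hΛ, rfl⟩

theorem traceProd_affineMatrixMap_sub (Λ F₀ : Matrix (Fin p) (Fin p) ℝ)
    (F : Fin n → Matrix (Fin p) (Fin p) ℝ) (x y : EuclideanSpace ℝ (Fin n)) :
    traceProd Λ (affineMatrixMap F₀ F y)
      = traceProd Λ (affineMatrixMap F₀ F x) + traceProdVec Λ F (y - x) := by
  rw [traceProd_affineMatrixMap, traceProd_affineMatrixMap, map_sub]
  ring

theorem traceProd_affineMatrixMap_le {F : Fin n → Matrix (Fin p) (Fin p) ℝ} {M : ℝ}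
    {Λ : Matrix (Fin p) (Fin p) ℝ} (hM : ‖traceProdVec Λ F‖ ≤ M) (F₀ : Matrix (Fin p) (Fin p) ℝ)
    (x y : EuclideanSpace ℝ (Fin n)) :
    traceProd Λ (affineMatrixMap F₀ F y)
      ≤ traceProd Λ (affineMatrixMap F₀ F x) + M * ‖y - x‖ := by
  rw [traceProd_affineMatrixMap_sub Λ F₀ F x y]
  gcongr
  exact (le_abs_self _).trans (((traceProdVec Λ F).le_opNorm _).trans (by gcongr))

theorem locallyLipschitz_sdConstraintMax (F₀ : Matrix (Fin p) (Fin p) ℝ)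
    (F : Fin n → Matrix (Fin p) (Fin p) ℝ) :
    LocallyLipschitz (sdConstraintMax (affineMatrixMap F₀ F)) := by
  obtain ⟨M, -, hM⟩ := exists_norm_traceProdVec_le F
  refine (LipschitzWith.of_le_add_mul' (max M 0) fun x y => ?_).locallyLipschitz
  -- The index set is empty for `p = 0`, where the supremum takes its default value `0`.
  rcases (unitPosSemidef p).eq_empty_or_nonempty with h0 | h0
  · simp only [sdConstraintMax, h0, Set.image_empty, Real.sSup_empty]
    positivity
  · refine csSup_le (h0.image _) ?_
    rintro _ ⟨Λ, hΛ, rfl⟩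
    refine (traceProd_affineMatrixMap_le ((hM Λ hΛ).trans (le_max_left M 0)) F₀ y x).trans ?_
    rw [dist_eq_norm]
    gcongr
    exact traceProd_le_sdConstraintMax _ hΛ y

theorem sdConstraintMax_nonpos {g : EuclideanSpace ℝ (Fin n) → Matrix (Fin p) (Fin p) ℝ}
    {x : EuclideanSpace ℝ (Fin n)} (hx : (-(g x)).PosSemidef) : sdConstraintMax g x ≤ 0 := by
  refine Real.sSup_le ?_ le_rfl
  rintro _ ⟨Λ, hΛ, rfl⟩
  have h := traceProd_nonneg hΛ.1 hx
  rw [traceProd_neg_right] at h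
  show traceProd Λ (g x) ≤ 0
  linarith

/-- The Slater condition in terms of the Clarke derivative yields a strictly feasible point. -/
theorem SlaterCondition.exists_dotProduct_mulVec_neg {Ω : Set (EuclideanSpace ℝ (Fin n))}
    {F₀ : Matrix (Fin p) (Fin p) ℝ} {F : Fin n → Matrix (Fin p) (Fin p) ℝ}
    {x : EuclideanSpace ℝ (Fin n)}
    (hU : SlaterCondition Ω (sdConstraintMax (affineMatrixMap F₀ F)) x)
    (hx : x ∈ sdFeasibleSet Ω (affineMatrixMap F₀ F)) :
    ∃ y ∈ Ω, ∀ v : Fin p → ℝ, v ≠ 0 → v ⬝ᵥ (affineMatrixMap F₀ F y).mulVec v < 0 := by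
  obtain ⟨d, hd, hneg⟩ := hU
  obtain ⟨M, hM0, hM⟩ := exists_norm_traceProdVec_le F
  set c := clarkeDirDeriv (sdConstraintMax (affineMatrixMap F₀ F)) x d with hc
  -- Along `d`, `G` drops by more than `t * (-c / 2)`; this tolerance keeps the cost of moving from
  -- `x + t • d` to a point of `Ω` within that drop. The `+ 1` avoids division by zero.
  have hε : 0 < -(c / 2) / (M + 1) := div_pos (by linarith) (by positivity)
  obtain ⟨t, ⟨h1, y, hy, h2⟩, ht⟩ :=
    ((eventually_ray_lt_of_clarkeDirDeriv_lt (locallyLipschitz_sdConstraintMax F₀ F)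
      (show c < c / 2 by linarith)).and
      (eventually_exists_mem_of_mem_clarkeTangentCone hx.1 hd hε)).and
      (eventually_mem_nhdsWithin (s := Set.Ioi (0 : ℝ))) |>.exists
  have ht : 0 < t := ht
  refine ⟨y, hy, fun v hv => ?_⟩
  have hΛ := smul_vecMulVec_mem_unitPosSemidef hv
  have h3 := traceProd_affineMatrixMap_le (hM _ hΛ) F₀ (x + t • d) y
  have h4 := traceProd_le_sdConstraintMax (affineMatrixMap F₀ F) hΛ (x + t • d)
  have h5 := sdConstraintMax_nonpos hx.2
  rw [norm_sub_rev] at h3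
  have h6 : M * ‖x + t • d - y‖ ≤ t * -(c / 2) :=
    calc M * ‖x + t • d - y‖ ≤ (M + 1) * (t * (-(c / 2) / (M + 1))) :=
          mul_le_mul (by linarith) h2.le (norm_nonneg _) (by positivity)
      _ = t * -(c / 2) := by field_simp
  have h7 : traceProd ((v ⬝ᵥ v)⁻¹ • Matrix.vecMulVec v v) (affineMatrixMap F₀ F y) < 0 := by
    linarith
  rw [traceProd_smul_left, traceProd_vecMulVec_self] at h7
  have h8 : 0 ≤ (v ⬝ᵥ v)⁻¹ :=
    inv_nonneg.2 (Finset.sum_nonneg fun i _ => mul_self_nonneg (v i))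
  by_contra! h9
  exact h7.not_ge (mul_nonneg h8 h9)

/-- At a quasi-weakly Pareto solution no direction into the feasible set is a common strict
descent direction for the perturbed Clarke derivatives. -/
theorem IsQuasiWeaklyPareto.not_exists_clarkeDirDeriv_lt {X : Type*} [NormedAddCommGroup X]
    [NormedSpace ℝ X] {m : ℕ} {f : Fin m → X → ℝ} (hf : ∀ i, LocallyLipschitz (f i)) {C : Set X}
    (hC : Convex ℝ C) {ξ : Fin m → ℝ} {x : X} (hx : IsQuasiWeaklyPareto f C ξ x) :
    ¬ ∃ y ∈ C, ∀ i, clarkeDirDeriv (f i) x (y - x) + ξ i * ‖y - x‖ < 0 := by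
  rintro ⟨y, hy, h⟩
  have h1 : ∀ᶠ t : ℝ in 𝓝[>] (0 : ℝ), ∀ i,
      f i (x + t • (y - x)) < f i x + t * -(ξ i * ‖y - x‖) :=
    eventually_all.2 fun i => eventually_ray_lt_of_clarkeDirDeriv_lt (hf i) (by linarith [h i])
  obtain ⟨t, ht, ht0, ht1⟩ := (h1.and (Ioo_mem_nhdsGT (one_pos : (0 : ℝ) < 1))).exists
  refine hx.2 ⟨x + t • (y - x), hC.add_smul_sub_mem hx.1 hy ⟨ht0.le, ht1.le⟩, fun i => ?_⟩
  have h2 := ht i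
  rw [add_sub_cancel_left, norm_smul, Real.norm_of_nonneg ht0.le]
  linarith

theorem convex_sdFeasibleSet {Ω : Set (EuclideanSpace ℝ (Fin n))} (hΩ : Convex ℝ Ω)
    (F₀ : Matrix (Fin p) (Fin p) ℝ) (F : Fin n → Matrix (Fin p) (Fin p) ℝ) :
    Convex ℝ (sdFeasibleSet Ω (affineMatrixMap F₀ F)) := by
  intro x hx y hy a b ha hb hab
  refine ⟨hΩ hx.1 hy.1 ha hb hab, ?_⟩
  rw [affineMatrixMap_add_smul F₀ F x y hab, neg_add, ← smul_neg, ← smul_neg]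
  exact (hx.2.smul ha).add (hy.2.smul hb)

end SemidefiniteConstraint

/-! ### Assembly of the multiplier rule. -/

theorem convexOn_clarkeDirDeriv_sub_add_norm {X : Type*} [NormedAddCommGroup X] [NormedSpace ℝ X]
    {φ : X → ℝ} (hφ : LocallyLipschitz φ) {S : Set X} (hS : Convex ℝ S) (x : X) {c : ℝ}
    (hc : 0 ≤ c) : ConvexOn ℝ S fun y => clarkeDirDeriv φ x (y - x) + c * ‖y - x‖ := by
  have h : ConvexOn ℝ Set.univ fun d => clarkeDirDeriv φ x d + c * ‖d‖ :=
    (convexOn_clarkeDirDeriv hφ x).add (convexOn_univ_norm.smul hc)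
  have h2 := (h.translate_left (-x)).subset (Set.subset_univ S) hS
  simpa only [Function.comp_def, ← sub_eq_add_neg] using h2

theorem mainTheorem5 {n m p : ℕ}
    (f : Fin m → EuclideanSpace ℝ (Fin n) → ℝ) (hf : ∀ i, LocallyLipschitz (f i))
    (Ω : Set (EuclideanSpace ℝ (Fin n)))
    (hΩne : Ω.Nonempty) (hΩcl : IsClosed Ω) (hΩconv : Convex ℝ Ω)
    (F₀ : Matrix (Fin p) (Fin p) ℝ) (F : Fin n → Matrix (Fin p) (Fin p) ℝ)
    (hF₀ : F₀.IsSymm) (hF : ∀ i, (F i).IsSymm)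
    (ξ : Fin m → ℝ) (hξ : ∀ i, 0 ≤ ξ i) (hξ0 : ξ ≠ 0)
    (xbar : EuclideanSpace ℝ (Fin n))
    (hx : IsQuasiWeaklyPareto f (sdFeasibleSet Ω (affineMatrixMap F₀ F)) ξ xbar)
    (hU : SlaterCondition Ω (sdConstraintMax (affineMatrixMap F₀ F)) xbar) :
    ∃ l : Fin m → ℝ, (∀ i, 0 ≤ l i) ∧ ∑ i, l i = 1 ∧
      ∃ Λ : Matrix (Fin p) (Fin p) ℝ, Λ.PosSemidef ∧
        (0 : StrongDual ℝ (EuclideanSpace ℝ (Fin n))) ∈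
          ∑ i, l i • clarkeSubdifferential (f i) xbar + {traceProdVec Λ F}
            + (∑ i, l i * ξ i) •
              Metric.closedBall (0 : StrongDual ℝ (EuclideanSpace ℝ (Fin n))) 1
            + clarkeNormalCone Ω xbar := by
  obtain ⟨l, hl, hl1, Λ, hΛ, h⟩ := exists_multipliers_of_not_exists_lt
    (h := fun i y => clarkeDirDeriv (f i) xbar (y - xbar) + ξ i * ‖y - xbar‖)
    (fun i => convexOn_clarkeDirDeriv_sub_add_norm (hf i) hΩconv xbar (hξ i)) hΩconv
    (g := affineMatrixMap F₀ F) (fun x y a b hab => affineMatrixMap_add_smul F₀ F x y hab)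
    (by
      rintro ⟨y, hy, h1, h2⟩
      refine hx.not_exists_clarkeDirDeriv_lt hf (convex_sdFeasibleSet hΩconv F₀ F)
        ⟨y, ⟨hy, .of_dotProduct_mulVec_nonneg (isHermitian_affineMatrixMap hF₀ hF y).neg
          fun v => ?_⟩, h1⟩
      rcases eq_or_ne v 0 with rfl | hv
      · simp
      · simpa [Matrix.neg_mulVec] using (h2 v hv).le)
    (hU.exists_dotProduct_mulVec_neg hx.1)
  refine ⟨l, hl, hl1, Λ, hΛ,
    zero_mem_sum_clarkeSubdifferential hf hΩconv hx.1.1 l _ _ fun y hy => ?_⟩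
  have h1 := h y hy
  -- Feasibility of `x̄` gives `Λ • g x̄ ≤ 0`, so this constant can be dropped from the affine
  -- expansion, leaving only the linear part.
  have h2 := traceProd_nonneg hΛ hx.1.2
  rw [traceProd_neg_right] at h2
  rw [traceProd_affineMatrixMap_sub Λ F₀ F xbar y] at h1
  simp only [mul_add, Finset.sum_add_distrib, ← mul_assoc, ← Finset.sum_mul] at h1
  linarith
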